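/- **Conventions.** All asymptotic dimensions take values in $\{0,1,2,\dots\}\cup\{\infty\}$. A metric space $(X,d)$ has $\operatorname{asdim} X\le n$ if for every $r>0$ there are $R$ and $n+1$ families $\mathcal U_0,\dots,\mathcal U_n$ of subsets of $X$ which together cover $X$, such that every member of every $\mathcal U_i$ has diameter at most $R$, and $d(x,y)>r$ whenever $x\in U$, $y\in V$ for distinct members $U,V$ of the same $\mathcal U_i$. The space $X$ is *geodesic* if any two points $x,y$ are joined by an isometrically embedded segment of length $d(x,y)$. For an arbitrary group $\Gamma$, $$\operatorname{asdim}\Gamma=\sup\{\operatorname{asdim} F\mid F\le\Gamma \text{ finitely generated}\},$$ where $F$ carries the word metric of a finite generating set (the choice does not matter). Equip $\Gamma$ with the coarse structure in which $E\subseteq\Gamma\times\Gamma$ is controlled if and only if $\{x^{-1}y\mid (x,y)\in E\}$ is finite (for countable $\Gamma$ this is the bounded coarse structure of any proper left invariant metric inducing the discrete topology). A subset $W\subseteq\Gamma$ has $\operatorname{asdim} W\le n$ if for every controlled $L$ there are a controlled $B$ and $n+1$ families $\mathcal U_0,\dots,\mathcal U_n$ of subsets of $W$ which together cover $W$, such that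 $U\times U\subseteq B$ for every member $U$ of every $\mathcal U_i$, and $(U\times V)\cap L=\emptyset$ for distinct members $U,V$ of the same $\mathcal U_i$. **Theorem.** Let an arbitrary group $\Gamma$ act by isometries on a geodesic metric space $X$, let $x_0\in X$ and $n\in\{0,1,2,\dots\}$, and suppose that for every $R>0$ the $R$-stabilizer $$W_R(x_0)=\{g\in\Gamma\mid d(g x_0,x_0)\le R\}$$ satisfies $\operatorname{asdim} W_R(x_0)\le n$. Then $$\operatorname{asdim}\Gamma\le n+\operatorname{asdim} X.$$ -/

import Mathlib

namespace AsymptoticDimension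

/-- A metric space is geodesic if any two points `x`, `y` are joined by an isometrically embedded
segment of length `dist x y`. -/
def IsGeodesicSpace (X : Type*) [MetricSpace X] : Prop :=
  ∀ x y : X, ∃ γ : ℝ → X, γ 0 = x ∧ γ (dist x y) = y ∧
    ∀ s ∈ Set.Icc 0 (dist x y), ∀ t ∈ Set.Icc 0 (dist x y), dist (γ s) (γ t) = |s - t|

/-- The family `U` of subsets is `R`-bounded for the distance function `δ`: every member has
diameter at most `R`. -/
def IsBoundedFamily {X : Type*} (δ : X → X → ℝ) (R : ℝ) (U : Set (Set X)) : Prop :=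
  ∀ A ∈ U, ∀ x ∈ A, ∀ y ∈ A, δ x y ≤ R

/-- The family `U` of subsets is `r`-disjoint for the distance function `δ`: points of distinct
members are at distance greater than `r`. -/
def IsDisjointFamily {X : Type*} (δ : X → X → ℝ) (r : ℝ) (U : Set (Set X)) : Prop :=
  ∀ A ∈ U, ∀ B ∈ U, A ≠ B → ∀ x ∈ A, ∀ y ∈ B, r < δ x y

/-- Gromov's definition: `(X, δ)` has asymptotic dimension at most `n`. -/
def HasAsdimLE {X : Type*} (δ : X → X → ℝ) (n : ℕ) : Prop :=
  ∀ r : ℝ, 0 < r → ∃ R : ℝ, ∃ U : Fin (n + 1) → Set (Set X),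
    (∀ i, IsBoundedFamily δ R (U i)) ∧ (∀ i, IsDisjointFamily δ r (U i)) ∧
      ∀ x : X, ∃ i, ∃ A ∈ U i, x ∈ A

/-- The asymptotic dimension of `(X, δ)`: the least `n` with `HasAsdimLE δ n`, and `⊤` if there
is none. -/
noncomputable def asdimOf {X : Type*} (δ : X → X → ℝ) : ℕ∞ :=
  ⨅ (n : ℕ) (_ : HasAsdimLE δ n), (n : ℕ∞)

/-- The asymptotic dimension of a metric space. -/
noncomputable def asdim (X : Type*) [MetricSpace X] : ℕ∞ :=
  asdimOf (fun x y : X => dist x y)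

/-- The word length of `g` with respect to `S`: the least length of a word in the elements of `S`
and their inverses that represents `g` (relevant only for `g` in the subgroup generated by `S`). -/
noncomputable def wordLength {Γ : Type*} [Group Γ] (S : Set Γ) (g : Γ) : ℕ :=
  sInf {k : ℕ | ∃ l : List Γ, l.length = k ∧ (∀ s ∈ l, s ∈ S ∨ s⁻¹ ∈ S) ∧ l.prod = g}

/-- The left invariant word metric on the subgroup generated by `S`. -/
noncomputable def wordDist {Γ : Type*} [Group Γ] (S : Set Γ) (x y : Subgroup.closure S) : ℝ :=
  (wordLength S ((x : Γ)⁻¹ * (y : Γ)) : ℝ)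

/-- The asymptotic dimension of an arbitrary group: the supremum of the asymptotic dimensions of
its finitely generated subgroups, each with the word metric of a finite generating set. Word metrics
of two finite generating sets of the same subgroup are quasi-isometric, so that taking the supremum
over all finite generating sets `S` is the same as choosing one for every subgroup. -/
noncomputable def groupAsdim (Γ : Type*) [Group Γ] : ℕ∞ :=
  ⨆ S : Finset Γ, asdimOf (wordDist (S : Set Γ))

/-- The controlled sets of the canonical coarse structure of a group: `E ⊆ Γ × Γ` is controlled
if `{x⁻¹ y | (x, y) ∈ E}` is finite. For a countable group this is the bounded coarse structure of
any proper left invariant metric that induces the discrete topology. -/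
def IsControlled {Γ : Type*} [Group Γ] (E : Set (Γ × Γ)) : Prop :=
  ((fun p : Γ × Γ => p.1⁻¹ * p.2) '' E).Finite

/-- The subset `W` of the group `Γ`, with the coarse structure restricted from `Γ`, has asymptotic
dimension at most `n`: for every controlled set `L` there are `n + 1` families of subsets of `W`,
together covering `W`, each of them `L`-disjoint and uniformly bounded. -/
def SubsetHasAsdimLE {Γ : Type*} [Group Γ] (W : Set Γ) (n : ℕ) : Prop :=
  ∀ L : Set (Γ × Γ), IsControlled L → ∃ B : Set (Γ × Γ), IsControlled B ∧
    ∃ U : Fin (n + 1) → Set (Set Γ),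
      (∀ i, ∀ A ∈ U i, A ⊆ W ∧ A ×ˢ A ⊆ B) ∧
      (∀ i, ∀ A ∈ U i, ∀ A' ∈ U i, A ≠ A' → Disjoint (A ×ˢ A') L) ∧
      ∀ x ∈ W, ∃ i, ∃ A ∈ U i, x ∈ A

/-- The asymptotic dimension of a subset of a group. -/
noncomputable def subsetAsdim {Γ : Type*} [Group Γ] (W : Set Γ) : ℕ∞ :=
  ⨅ (n : ℕ) (_ : SubsetHasAsdimLE W n), (n : ℕ∞)

/-- The `R`-stabilizer of the point `x₀`. -/
def rStabilizer (Γ : Type*) {X : Type*} [Group Γ] [MetricSpace X] [MulAction Γ X]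
    (R : ℝ) (x₀ : X) : Set Γ :=
  {g : Γ | dist (g • x₀) x₀ ≤ R}

end AsymptoticDimension

/-!
The theorem is a Hurewicz theorem for the orbit map `g ↦ g • x₀` from `Γ`, with its canonical coarse
structure, to `X`. The orbit map sends controlled sets to controlled sets because the action is
isometric, and a set of bounded image is a left translate of a subset of some `R`-stabilizer, so
that all these sets have asymptotic dimension at most `n` uniformly
(`hasUniformMulticovers_orbit`). Restricted to the subgroup generated by a finite set, the coarse
structure of `Γ` is that of the word metric (`hasAsdimLE_wordDist`).

The Hurewicz theorem `CoarseStructure.hurewicz` holds for coarse spaces in general. Say that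
`f : α → β` has target of dimension at most `n` and fibres of dimension at most `m`, and put
`k = m + n + 1`. By the Kolmogorov–Ostrand trick (`HasMulticover.succ`), a cover by `n + 1` sets
with bounded components can be replaced by `k` sets `B i` that contain every point at least
`k - n = m + 1` times. Likewise the fibres are covered by `k` sets that contain every point at
least `k - m = n + 1` times, and these can be chosen as the traces of `k` global sets `A i`
(`CoarseStructure.hasFiberwiseMulticovers_univ`): this is possible over one set with bounded
components in the target, and finitely many of these suffice, by a union lemma
(`HasBoundedComponents.union`). As `(m + 1) + (n + 1) > k`, every point lies in `A i ∩ f ⁻¹' B i`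
for some `i`. A chain in `A i ∩ f ⁻¹' B i` has bounded image, as it stays in a component of `B i`;
hence it stays in the trace of `A i` on a set of bounded image, and is bounded.
-/

namespace AsymptoticDimension

open Relation

/-! ### Components of a set with respect to a relation -/

/-- One step of an `E`-chain inside `A`. -/
def StepIn {α : Type*} (E : α → α → Prop) (A : Set α) (x y : α) : Prop :=
  E x y ∧ x ∈ A ∧ y ∈ A

/-- The `E`-components of `A` are `D`-bounded: points of `A` that are joined by an `E`-chain inside
`A` are related by `D`. -/
def HasBoundedComponents {α : Type*} (E D : α → α → Prop) (A : Set α) : Prop :=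
  ∀ x ∈ A, ∀ y, ReflTransGen (StepIn E A) x y → D x y

section Components

variable {α β : Type*} {E E' D D' : α → α → Prop} {A A' : Set α}

theorem mem_of_chain {x y : α} (hx : x ∈ A) (h : ReflTransGen (StepIn E A) x y) : y ∈ A := by
  cases h with
  | refl => exact hx
  | tail _ h => exact h.2.2

theorem chain_symm (hE : ∀ ⦃x y⦄, E x y → E y x) : ∀ ⦃x y⦄,
    ReflTransGen (StepIn E A) x y → ReflTransGen (StepIn E A) y x := fun _ _ h =>
  have : Std.Symm (StepIn E A) := ⟨fun _ _ h => ⟨hE h.1, h.2.2, h.2.1⟩⟩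
  ReflTransGen.stdSymm.symm _ _ h

theorem HasBoundedComponents.mono (h : HasBoundedComponents E D A) (hE : E' ≤ E) (hD : D ≤ D')
    (hA : A' ⊆ A) : HasBoundedComponents E' D' A' := fun x hx y hxy =>
  hD x y (h x (hA hx) y (ReflTransGen.mono
    (fun u v huv => ⟨hE u v huv.1, hA huv.2.1, hA huv.2.2⟩) x y hxy))

theorem hasBoundedComponents_empty : HasBoundedComponents E D ∅ := fun _ hx => hx.elim

theorem HasBoundedComponents.preimage {E D : β → β → Prop} {A : Set β}
    (h : HasBoundedComponents E D A) (f : α → β) (hE : ∀ x y, E' x y → E (f x) (f y)) :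
    HasBoundedComponents E' (fun x y => D (f x) (f y)) (f ⁻¹' A) := fun x hx y hxy =>
  h (f x) hx (f y) (hxy.lift f fun u v huv => ⟨hE u v huv.1, huv.2.1, huv.2.2⟩)

/-- The union of an `E`-disjoint family of `D`-bounded sets has `D`-bounded `E`-components, because
an `E`-chain cannot leave a member of the family. -/
theorem hasBoundedComponents_sUnion {U : Set (Set α)} (hD : ∀ V ∈ U, ∀ x ∈ V, ∀ y ∈ V, D x y)
    (hE : ∀ V ∈ U, ∀ V' ∈ U, V ≠ V' → ∀ x ∈ V, ∀ y ∈ V', ¬ E x y) :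
    HasBoundedComponents E D (⋃₀ U) := by
  rintro x ⟨V, hV, hxV⟩ y hxy
  refine hD V hV x hxV y ?_
  induction hxy with
  | refl => exact hxV
  | @tail u v _ huv ih =>
    obtain ⟨hE', -, V', hV', hv⟩ := huv
    by_cases h : V = V'
    · exact h ▸ hv
    · exact (hE V hV V' hV' h u ih v hv hE').elim

/-- The components of a set form an `E`-disjoint family of `D`-bounded sets. -/
theorem HasBoundedComponents.exists_family (h : HasBoundedComponents E D A)
    (hE : ∀ ⦃x y⦄, E x y → E y x) :
    ∃ U : Set (Set α), (∀ V ∈ U, ∀ x ∈ V, ∀ y ∈ V, D x y) ∧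
      (∀ V ∈ U, ∀ V' ∈ U, V ≠ V' → ∀ x ∈ V, ∀ y ∈ V', ¬ E x y) ∧ ⋃₀ U = A := by
  refine ⟨{V | ∃ x ∈ A, V = {y | ReflTransGen (StepIn E A) x y}}, ?_, ?_, ?_⟩
  · rintro _ ⟨a, ha, rfl⟩ x hx y hy
    exact h x (mem_of_chain ha hx) y ((chain_symm hE hx).trans hy)
  · rintro _ ⟨a, ha, rfl⟩ _ ⟨b, hb, rfl⟩ hne x hx y hy hxy
    have hab : ReflTransGen (StepIn E A) a b :=
      (hx.tail ⟨hxy, mem_of_chain ha hx, mem_of_chain hb hy⟩).trans (chain_symm hE hy)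
    exact hne (Set.ext fun z => ⟨fun hz => (chain_symm hE hab).trans hz, fun hz => hab.trans hz⟩)
  · ext x
    constructor
    · rintro ⟨_, ⟨a, ha, rfl⟩, hx⟩
      exact mem_of_chain ha hx
    · exact fun hx => ⟨_, ⟨x, hx, rfl⟩, ReflTransGen.refl⟩

/-- If the `E`-components of `A` are `D`-bounded and those of `A'` are `D'`-bounded at the larger
scale `E ∘ D ∘ E`, then the `E`-components of the union are bounded. An `E`-chain in the union
makes excursions into `A` between its visits to `A'`; each excursion has size at most `E ∘ D ∘ E`,
so the visits to `A'` form a chain at that scale. -/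
theorem HasBoundedComponents.union (hErefl : ∀ x, E x x) (hDrefl : ∀ x, D x x)
    (hDrefl' : ∀ x, D' x x) (h : HasBoundedComponents E D A)
    (h' : HasBoundedComponents (Comp (Comp E D) E) D' A') :
    HasBoundedComponents E (Comp (Comp (Comp (Comp E D) E) D') (Comp (Comp E D) E))
      (A ∪ A') := by
  intro x hx y hxy
  have hG : ∀ z, Comp (Comp E D) E z z := fun z => ⟨z, ⟨z, hErefl z, hDrefl z⟩, hErefl z⟩
  have key : (x ∈ A ∧ ReflTransGen (StepIn E A) x y) ∨
      ∃ u v, u ∈ A' ∧ Comp (Comp E D) E x u ∧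
        ReflTransGen (StepIn (Comp (Comp E D) E) A') u v ∧
        (v = y ∨ ∃ w ∈ A, E v w ∧ ReflTransGen (StepIn E A) w y) := by
    induction hxy with
    | refl =>
      rcases hx with hx | hx
      · exact Or.inl ⟨hx, .refl⟩
      · exact Or.inr ⟨x, x, hx, hG x, .refl, Or.inl rfl⟩
    | @tail y z _ hyz ih =>
      obtain ⟨hyz, -, hz⟩ := hyz
      rcases ih with ⟨hxA, hxy⟩ | ⟨u, v, hu, hxu, huv, hvy⟩
      · rcases hz with hz | hz
        · exact Or.inl ⟨hxA, hxy.tail ⟨hyz, mem_of_chain hxA hxy, hz⟩⟩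
        · exact Or.inr ⟨z, z, hz, ⟨y, ⟨x, hErefl x, h x hxA y hxy⟩, hyz⟩, .refl, Or.inl rfl⟩
      · have hv := mem_of_chain hu huv
        refine Or.inr ?_
        rcases hz with hz | hz
        · rcases hvy with rfl | ⟨w, hw, hvw, hwy⟩
          · exact ⟨u, v, hu, hxu, huv, Or.inr ⟨z, hz, hyz, .refl⟩⟩
          · exact ⟨u, v, hu, hxu, huv, Or.inr ⟨w, hw, hvw,
              hwy.tail ⟨hyz, mem_of_chain hw hwy, hz⟩⟩⟩
        · refine ⟨u, z, hu, hxu, huv.tail ⟨?_, hv, hz⟩, Or.inl rfl⟩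
          rcases hvy with rfl | ⟨w, hw, hvw, hwy⟩
          · exact ⟨v, ⟨v, hErefl v, hDrefl v⟩, hyz⟩
          · exact ⟨y, ⟨w, hvw, h w hw y hwy⟩, hyz⟩
  rcases key with ⟨hxA, hxy⟩ | ⟨u, v, hu, hxu, huv, hvy⟩
  · exact ⟨y, ⟨y, ⟨y, ⟨x, hErefl x, h x hxA y hxy⟩, hErefl y⟩, hDrefl' y⟩, hG y⟩
  · refine ⟨v, ⟨u, hxu, h' u hu v huv⟩, ?_⟩
    rcases hvy with rfl | ⟨w, hw, hvw, hwy⟩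
    · exact hG v
    · exact ⟨y, ⟨w, hvw, h w hw y hwy⟩, hErefl y⟩

/-- The `E`-neighbourhood of a set with bounded `E ∘ E ∘ E`-components has bounded
`E`-components. -/
theorem HasBoundedComponents.neighborhood (hE : ∀ ⦃x y⦄, E x y → E y x)
    (h : HasBoundedComponents (Comp (Comp E E) E) D A) :
    HasBoundedComponents E (Comp (Comp E D) E) {x | ∃ a ∈ A, E x a} := by
  rintro x ⟨a, ha, hxa⟩ y hxy
  have key : ∃ b, E y b ∧ ReflTransGen (StepIn (Comp (Comp E E) E) A) a b := by
    induction hxy with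
    | refl => exact ⟨a, hxa, .refl⟩
    | @tail y z _ hyz ih =>
      obtain ⟨b, hyb, hab⟩ := ih
      obtain ⟨hyz, -, c, hc, hzc⟩ := hyz
      exact ⟨c, hzc, hab.tail ⟨⟨z, ⟨y, hE hyb, hyz⟩, hzc⟩, mem_of_chain ha hab, hc⟩⟩
  obtain ⟨b, hyb, hab⟩ := key
  exact ⟨b, ⟨a, hxa, h a ha b hab⟩, hE hyb⟩

end Components

/-! ### Multicovers and the Kolmogorov–Ostrand trick -/

section Multicover

open Classical in
/-- The number of indices `i < k` with `x ∈ A i`. -/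
noncomputable def multiplicity {α : Type*} (k : ℕ) (A : ℕ → Set α) (x : α) : ℕ :=
  ((Finset.range k).filter fun i => x ∈ A i).card

variable {α : Type*} {E D : α → α → Prop} {k c : ℕ} {W : Set α} {A A' : ℕ → Set α} {x : α}

theorem multiplicity_mono (h : ∀ i < k, x ∈ A i → x ∈ A' i) :
    multiplicity k A x ≤ multiplicity k A' x := by
  classical
  refine Finset.card_le_card fun i hi => ?_
  simp only [Finset.mem_filter, Finset.mem_range] at hi ⊢
  exact ⟨hi.1, h i hi.1 hi.2⟩

theorem multiplicity_pos_iff : 0 < multiplicity k A x ↔ ∃ i < k, x ∈ A i := by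
  simp [multiplicity, Finset.card_pos, Finset.Nonempty]

theorem multiplicity_succ_of_mem (h : x ∈ A k) :
    multiplicity (k + 1) A x = multiplicity k A x + 1 := by
  classical
  rw [multiplicity, Finset.range_add_one, Finset.filter_insert, if_pos h,
    Finset.card_insert_of_notMem (by simp)]
  rfl

theorem multiplicity_le_succ : multiplicity k A x ≤ multiplicity (k + 1) A x := by
  classical
  exact Finset.card_le_card (Finset.filter_subset_filter _ (by simp))

/-- If `A i ⊆ A' i` and `x` has the same multiplicity with respect to both, then it lies in the
same members of both. -/
theorem mem_of_multiplicity_le (h : ∀ i < k, x ∈ A i → x ∈ A' i)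
    (hle : multiplicity k A' x ≤ multiplicity k A x) {i : ℕ} (hi : i < k) (hx : x ∈ A' i) :
    x ∈ A i := by
  classical
  have hsub : ((Finset.range k).filter fun i => x ∈ A i) ⊆
      (Finset.range k).filter fun i => x ∈ A' i := fun i hi => by
    simp only [Finset.mem_filter, Finset.mem_range] at hi ⊢
    exact ⟨hi.1, h i hi.1 hi.2⟩
  have heq := Finset.eq_of_subset_of_card_le hsub (by simpa [multiplicity] using hle)
  have : i ∈ (Finset.range k).filter fun i => x ∈ A' i := by simp [hi, hx]
  rw [← heq] at this
  exact (Finset.mem_filter.1 this).2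

theorem exists_mem_inter_of_lt_multiplicity_add
    (h : k < multiplicity k A x + multiplicity k A' x) : ∃ i < k, x ∈ A i ∧ x ∈ A' i := by
  classical
  have hsub : ((Finset.range k).filter fun i => x ∈ A i) ∪
      ((Finset.range k).filter fun i => x ∈ A' i) ⊆ Finset.range k :=
    Finset.union_subset (Finset.filter_subset _ _) (Finset.filter_subset _ _)
  have h1 := Finset.card_le_card hsub
  have h2 := Finset.card_union_add_card_inter ((Finset.range k).filter fun i => x ∈ A i)
    ((Finset.range k).filter fun i => x ∈ A' i)
  rw [Finset.card_range] at h1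
  have h3 : 0 < (((Finset.range k).filter fun i => x ∈ A i) ∩
      ((Finset.range k).filter fun i => x ∈ A' i)).card := by
    simp only [multiplicity] at h
    omega
  obtain ⟨i, hi⟩ := Finset.card_pos.1 h3
  simp only [Finset.mem_inter, Finset.mem_filter, Finset.mem_range] at hi
  exact ⟨i, hi.1.1, hi.1.2, hi.2.2⟩

/-- There are `k` sets with `D`-bounded `E`-components such that every point of `W` lies in at
least `c` of them. The sets need not be contained in `W`. -/
def HasMulticover (W : Set α) (E D : α → α → Prop) (k c : ℕ) : Prop :=
  ∃ A : ℕ → Set α, (∀ i < k, HasBoundedComponents E D (A i)) ∧ ∀ x ∈ W, c ≤ multiplicity k A x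

/-- The step of the Kolmogorov–Ostrand trick: one further set raises the multiplicity by one.
Enlarge the given sets to their `E`-neighbourhoods, and let the new set consist of the points of
`W` that have multiplicity exactly `c` with respect to the neighbourhoods. Such points belong to
the same members of the original cover if they are joined by an `E`-chain in the new set. -/
theorem HasMulticover.succ (hErefl : ∀ x, E x x) (hE : ∀ ⦃x y⦄, E x y → E y x) (hc : 0 < c)
    (h : HasMulticover W (Comp (Comp E E) E) D k c) :
    HasMulticover W E (Comp (Comp E D) E) (k + 1) (c + 1) := by
  obtain ⟨A, hA, hcov⟩ := h
  let N : ℕ → Set α := fun i => {x | ∃ a ∈ A i, E x a}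
  let L : Set α := {x | x ∈ W ∧ multiplicity k N x ≤ c}
  have hAN : ∀ x, ∀ i < k, x ∈ A i → x ∈ N i := fun x i _ hx => ⟨x, hx, hErefl x⟩
  have hL : ∀ x ∈ L, ∀ i < k, x ∈ N i → x ∈ A i := fun x hx i hi hxi =>
    mem_of_multiplicity_le (hAN x) (hx.2.trans (hcov x hx.1)) hi hxi
  let A' : ℕ → Set α := fun i => if i < k then N i else L
  have hA'N : ∀ i < k, A' i = N i := fun i hi => if_pos hi
  have hA'L : A' k = L := if_neg (lt_irrefl k)
  have hmult : ∀ x, multiplicity k N x ≤ multiplicity k A' x := fun x =>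
    multiplicity_mono fun i hi hx => by rwa [hA'N i hi]
  refine ⟨A', fun i hi => ?_, fun x hx => ?_⟩
  · rcases Nat.lt_succ_iff_lt_or_eq.1 hi with hi | rfl
    · rw [hA'N i hi]
      exact (hA i hi).neighborhood hE
    · rw [hA'L]
      intro x hx y hxy
      obtain ⟨j, hj, hxj⟩ := multiplicity_pos_iff.1 (hc.trans_le (hcov x hx.1))
      have key : y ∈ A j ∧ ReflTransGen (StepIn (Comp (Comp E E) E) (A j)) x y := by
        induction hxy with
        | refl => exact ⟨hxj, .refl⟩
        | @tail y z _ hyz ih =>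
          obtain ⟨hyz, -, hz⟩ := hyz
          have hzj := hL z hz j hj ⟨y, ih.1, hE hyz⟩
          exact ⟨hzj, ih.2.tail ⟨⟨y, ⟨y, hErefl y, hErefl y⟩, hyz⟩, ih.1, hzj⟩⟩
      exact ⟨y, ⟨x, hErefl x, hA j hj x hxj y key.2⟩, hErefl y⟩
  · by_cases h : multiplicity k N x ≤ c
    · rw [multiplicity_succ_of_mem (by rw [hA'L]; exact ⟨hx, h⟩)]
      have h1 := hcov x hx
      have h2 : multiplicity k A x ≤ multiplicity k N x := multiplicity_mono (hAN x)
      have := hmult x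
      omega
    · exact (not_le.1 h).trans_le ((hmult x).trans multiplicity_le_succ)

end Multicover

/-! ### Coarse structures -/

/-- A coarse structure, given by its controlled relations. -/
structure CoarseStructure (α : Type*) where
  /-- The controlled relations. -/
  Controlled : (α → α → Prop) → Prop
  mono : ∀ {E E'}, Controlled E → E' ≤ E → Controlled E'
  eq : Controlled (· = ·)
  sup : ∀ {E E'}, Controlled E → Controlled E' → Controlled (E ⊔ E')
  swap : ∀ {E}, Controlled E → Controlled (Function.swap E)
  comp : ∀ {E E'}, Controlled E → Controlled E' → Controlled (Comp E E')

namespace CoarseStructure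

variable {α β : Type*} (𝓐 : CoarseStructure α) (𝓑 : CoarseStructure β)

theorem exists_reflexive_symmetric {E : α → α → Prop} (hE : 𝓐.Controlled E) :
    ∃ E', 𝓐.Controlled E' ∧ E ≤ E' ∧ (∀ x, E' x x) ∧ ∀ ⦃x y⦄, E' x y → E' y x := by
  refine ⟨E ⊔ Function.swap E ⊔ (· = ·), 𝓐.sup (𝓐.sup hE (𝓐.swap hE)) 𝓐.eq,
    fun x y h => Or.inl (Or.inl h), fun x => Or.inr rfl, ?_⟩
  rintro x y ((h | h) | h)
  · exact Or.inl (Or.inr h)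
  · exact Or.inl (Or.inl h)
  · exact Or.inr h.symm

/-- At every scale, the sets `W ∈ 𝒲` have multicovers by `k` sets of multiplicity `c`, bounded
uniformly in `W`. For `k = n + 1` and `c = 1` this says that the members of `𝒲` have asymptotic
dimension at most `n` uniformly. -/
def HasUniformMulticovers (𝒲 : Set (Set α)) (k c : ℕ) : Prop :=
  ∀ E, 𝓐.Controlled E → ∃ D, 𝓐.Controlled D ∧ ∀ W ∈ 𝒲, HasMulticover W E D k c

variable {𝓐 𝓑}

/-- The Kolmogorov–Ostrand trick. -/
theorem HasUniformMulticovers.add {𝒲 : Set (Set α)} {k c : ℕ} (hc : 0 < c)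
    (h : 𝓐.HasUniformMulticovers 𝒲 k c) (j : ℕ) :
    𝓐.HasUniformMulticovers 𝒲 (k + j) (c + j) := by
  induction j with
  | zero => exact h
  | succ j ih =>
    intro E hE
    obtain ⟨E', hE', hle, hrefl, hsymm⟩ := 𝓐.exists_reflexive_symmetric hE
    obtain ⟨D, hD, hcov⟩ := ih _ (𝓐.comp (𝓐.comp hE' hE') hE')
    refine ⟨_, 𝓐.comp (𝓐.comp hE' hD) hE', fun W hW => ?_⟩
    obtain ⟨A, hA, hA'⟩ := (hcov W hW).succ hrefl hsymm (by omega)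
    exact ⟨A, fun i hi => (hA i hi).mono hle le_rfl subset_rfl, hA'⟩

/-- At every scale `E`, there are `k` subsets of `α` that cover every point of `W` at least `c`
times, such that their intersections with all sets of `S`-bounded image under `f` have uniformly
bounded `E`-components. In contrast to uniform multicovers of the sets with `S`-bounded image,
the `k` subsets are the same for all these sets. -/
def HasFiberwiseMulticovers (𝓐 : CoarseStructure α) (f : α → β) (S : β → β → Prop) (W : Set α)
    (k c : ℕ) : Prop :=
  ∀ E, 𝓐.Controlled E → ∃ D, 𝓐.Controlled D ∧ ∃ A : ℕ → Set α,
    (∀ i < k, ∀ C : Set α, (∀ x ∈ C, ∀ y ∈ C, S (f x) (f y)) →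
      HasBoundedComponents E D (A i ∩ C)) ∧ ∀ x ∈ W, c ≤ multiplicity k A x

theorem HasFiberwiseMulticovers.union {f : α → β} {S : β → β → Prop} {W W' : Set α} {k c : ℕ}
    (h : 𝓐.HasFiberwiseMulticovers f S W k c) (h' : 𝓐.HasFiberwiseMulticovers f S W' k c) :
    𝓐.HasFiberwiseMulticovers f S (W ∪ W') k c := by
  intro E₀ hE₀
  obtain ⟨E, hE, hle, hErefl, -⟩ := 𝓐.exists_reflexive_symmetric hE₀
  obtain ⟨D₀, hD₀, A, hA, hAW⟩ := h E hE
  obtain ⟨D, hD, hDle, hDrefl, -⟩ := 𝓐.exists_reflexive_symmetric hD₀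
  have hG := 𝓐.comp (𝓐.comp hE hD) hE
  obtain ⟨D₁, hD₁, A', hA', hAW'⟩ := h' _ hG
  obtain ⟨D', hD', hDle', hDrefl', -⟩ := 𝓐.exists_reflexive_symmetric hD₁
  refine ⟨_, 𝓐.comp (𝓐.comp hG hD') hG, fun i => A i ∪ A' i, fun i hi C hC => ?_, ?_⟩
  · rw [Set.union_inter_distrib_right]
    exact (HasBoundedComponents.union hErefl hDrefl hDrefl'
      ((hA i hi C hC).mono le_rfl hDle subset_rfl)
      ((hA' i hi C hC).mono le_rfl hDle' subset_rfl)).mono hle le_rfl subset_rfl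
  · rintro x (hx | hx)
    · exact (hAW x hx).trans (multiplicity_mono fun i _ h => Or.inl h)
    · exact (hAW' x hx).trans (multiplicity_mono fun i _ h => Or.inr h)

/-- Multicovers of the preimages of the components of `B` are put together to a fiberwise
multicover of the preimage of `B`: a set of `S`-bounded image meets the preimage of at most one
`S`-component of `B`. -/
theorem hasFiberwiseMulticovers_preimage {f : α → β} {S T : β → β → Prop} {B : Set β} {k c : ℕ}
    (hS : ∀ ⦃x y⦄, S x y → S y x) (hB : HasBoundedComponents S T B)
    (h : 𝓐.HasUniformMulticovers {C | ∀ x ∈ C, ∀ y ∈ C, T (f x) (f y)} k c) :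
    𝓐.HasFiberwiseMulticovers f S (f ⁻¹' B) k c := by
  intro E hE
  obtain ⟨D, hD, hcov⟩ := h E hE
  obtain ⟨U, hUT, hUS, rfl⟩ := hB.exists_family hS
  have hchoice : ∀ V : Set β, ∃ A : ℕ → Set α, V ∈ U →
      (∀ i < k, HasBoundedComponents E D (A i)) ∧ ∀ x ∈ f ⁻¹' V, c ≤ multiplicity k A x := by
    intro V
    by_cases hV : V ∈ U
    · obtain ⟨A, hA⟩ := hcov (f ⁻¹' V) fun x hx y hy => hUT V hV _ hx _ hy
      exact ⟨A, fun _ => hA⟩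
    · exact ⟨fun _ => ∅, fun h => (hV h).elim⟩
  choose A hA using hchoice
  refine ⟨D, hD, fun i => {x | ∃ V ∈ U, f x ∈ V ∧ x ∈ A V i}, fun i hi C hC x hx y hxy => ?_, ?_⟩
  · obtain ⟨⟨V, hV, hxV, hxA⟩, hxC⟩ := hx
    have hsub : ∀ z ∈ {x | ∃ V ∈ U, f x ∈ V ∧ x ∈ A V i} ∩ C, z ∈ A V i := by
      rintro z ⟨⟨V', hV', hzV', hzA⟩, hzC⟩
      by_cases hne : V = V'
      · exact hne ▸ hzA
      · exact (hUS V hV V' hV' hne _ hxV _ hzV' (hC x hxC z hzC)).elim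
    exact (((hA V hV).1 i hi).mono le_rfl le_rfl hsub) x ⟨⟨V, hV, hxV, hxA⟩, hxC⟩ y hxy
  · rintro x ⟨V, hV, hxV⟩
    exact ((hA V hV).2 x hxV).trans (multiplicity_mono fun i _ hi => ⟨V, hV, hxV, hi⟩)

/-- If the target has finite asymptotic dimension, then uniform multicovers of the sets of bounded
image can be chosen globally. -/
theorem hasFiberwiseMulticovers_univ {f : α → β} {k c n : ℕ}
    (hβ : 𝓑.HasUniformMulticovers {Set.univ} n 1)
    (h : ∀ T, 𝓑.Controlled T →
      𝓐.HasUniformMulticovers {C | ∀ x ∈ C, ∀ y ∈ C, T (f x) (f y)} k c)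
    {S : β → β → Prop} (hS : 𝓑.Controlled S) :
    𝓐.HasFiberwiseMulticovers f S Set.univ k c := by
  obtain ⟨S', hS', hle, -, hsymm⟩ := 𝓑.exists_reflexive_symmetric hS
  obtain ⟨T, hT, hcov⟩ := hβ S' hS'
  obtain ⟨B, hB, hBcov⟩ := hcov _ rfl
  have key : ∀ N ≤ n, 𝓐.HasFiberwiseMulticovers f S' {x | ∃ i < N, f x ∈ B i} k c := by
    intro N hN
    induction N with
    | zero =>
      exact fun E _ => ⟨_, 𝓐.eq, fun _ => ∅,
        fun i _ C _ => hasBoundedComponents_empty.mono le_rfl le_rfl Set.inter_subset_left,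
        fun x ⟨i, hi, _⟩ => (Nat.not_lt_zero i hi).elim⟩
    | succ N ih =>
      have := (ih (by omega)).union (hasFiberwiseMulticovers_preimage hsymm (hB N hN) (h T hT))
      convert this using 1
      ext x
      simp only [Set.mem_ofPred_eq, Set.mem_union, Set.mem_preimage, Nat.lt_succ_iff_lt_or_eq,
        or_and_right, exists_or, exists_eq_left]
  intro E hE
  obtain ⟨D, hD, A, hA, hAcov⟩ := key n le_rfl E hE
  refine ⟨D, hD, A, fun i hi C hC => hA i hi C fun x hx y hy => hle _ _ (hC x hx y hy),
    fun x _ => hAcov x ?_⟩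
  exact multiplicity_pos_iff.1 (hBcov (f x) trivial)

/-- The Hurewicz theorem for asymptotic dimension of coarse spaces: if `f` maps controlled
relations to controlled relations, the target has asymptotic dimension at most `n`, and the sets of
bounded image have asymptotic dimension at most `m` uniformly, then the source has asymptotic
dimension at most `m + n`. -/
theorem hurewicz {f : α → β} {m n : ℕ}
    (hf : ∀ E, 𝓐.Controlled E → ∃ E', 𝓑.Controlled E' ∧ ∀ x y, E x y → E' (f x) (f y))
    (hβ : 𝓑.HasUniformMulticovers {Set.univ} (n + 1) 1)
    (h : ∀ T, 𝓑.Controlled T →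
      𝓐.HasUniformMulticovers {C | ∀ x ∈ C, ∀ y ∈ C, T (f x) (f y)} (m + 1) 1) :
    𝓐.HasUniformMulticovers {Set.univ} (m + n + 1) 1 := by
  intro E hE
  obtain ⟨E', hE', hEE'⟩ := hf E hE
  obtain ⟨S, hS, hScov⟩ := hβ.add one_pos m E' hE'
  obtain ⟨B, hB, hBcov⟩ := hScov _ rfl
  -- Points reached by chains from a common point are related by `S⁻¹ ∘ S`.
  obtain ⟨D, hD, A, hA, hAcov⟩ := hasFiberwiseMulticovers_univ hβ
    (fun T hT => (h T hT).add one_pos n) (𝓑.comp (𝓑.swap hS) hS) E hE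
  rw [show n + 1 + m = m + n + 1 by omega] at hB hBcov
  rw [show m + 1 + n = m + n + 1 by omega] at hA hAcov
  refine ⟨D, hD, ?_⟩
  rintro _ rfl
  refine ⟨fun i => A i ∩ f ⁻¹' B i, fun i hi x hx y hxy => ?_, fun x _ => ?_⟩
  · let C : Set α := {z | ReflTransGen (StepIn E (A i ∩ f ⁻¹' B i)) x z}
    have hSC : ∀ z ∈ C, S (f x) (f z) := fun z hz =>
      ((hB i hi).preimage f hEE').mono le_rfl le_rfl Set.inter_subset_right x hx z hz
    refine hA i hi C (fun u hu v hv => ⟨f x, hSC u hu, hSC v hv⟩) x ⟨hx.1, .refl⟩ y ?_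
    have key : y ∈ C ∧ ReflTransGen (StepIn E (A i ∩ C)) x y := by
      induction hxy with
      | refl => exact ⟨.refl, .refl⟩
      | @tail y z _ hyz ih =>
        have hz : z ∈ C := ih.1.tail hyz
        exact ⟨hz, ih.2.tail ⟨hyz.1, ⟨hyz.2.1.1, ih.1⟩, ⟨hyz.2.2.1, hz⟩⟩⟩
    exact key.2
  · have h1 := hBcov (f x) trivial
    have h2 := hAcov x trivial
    exact multiplicity_pos_iff.2 (exists_mem_inter_of_lt_multiplicity_add
      (A' := fun i => f ⁻¹' B i) (by
        change _ < _ + multiplicity (m + n + 1) B (f x)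
        omega))

end CoarseStructure

/-! ### Metric spaces and groups as coarse spaces -/

/-- The bounded coarse structure of a metric space. -/
def metricCoarseStructure (X : Type*) [MetricSpace X] : CoarseStructure X where
  Controlled E := ∃ R : ℝ, ∀ x y, E x y → dist x y ≤ R
  mono := fun ⟨R, hR⟩ h => ⟨R, fun x y hxy => hR x y (h x y hxy)⟩
  eq := ⟨0, fun x y h => by simp [h]⟩
  sup := fun ⟨R, hR⟩ ⟨R', hR'⟩ => ⟨max R R', fun x y h =>
    h.elim (fun h => (hR x y h).trans (le_max_left _ _))
      fun h => (hR' x y h).trans (le_max_right _ _)⟩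
  swap := fun ⟨R, hR⟩ => ⟨R, fun x y h => dist_comm x y ▸ hR y x h⟩
  comp := fun ⟨R, hR⟩ ⟨R', hR'⟩ => ⟨R + R', fun x z ⟨y, hxy, hyz⟩ =>
    (dist_triangle x y z).trans (add_le_add (hR x y hxy) (hR' y z hyz))⟩

/-- The canonical coarse structure of a group: `E` is controlled if `x⁻¹ * y` takes finitely many
values on the pairs with `E x y`. -/
def groupCoarseStructure (Γ : Type*) [Group Γ] : CoarseStructure Γ where
  Controlled E := ∃ F : Set Γ, F.Finite ∧ ∀ x y, E x y → x⁻¹ * y ∈ F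
  mono := fun ⟨F, hF, h⟩ hle => ⟨F, hF, fun x y hxy => h x y (hle x y hxy)⟩
  eq := ⟨{1}, Set.finite_singleton 1, fun x y h => by simp [h]⟩
  sup := fun ⟨F, hF, h⟩ ⟨F', hF', h'⟩ => ⟨F ∪ F', hF.union hF', fun x y hxy =>
    hxy.imp (h x y) (h' x y)⟩
  swap := fun ⟨F, hF, h⟩ => ⟨(·⁻¹) '' F, hF.image _, fun x y hxy => ⟨_, h y x hxy, by simp⟩⟩
  comp := fun ⟨F, hF, h⟩ ⟨F', hF', h'⟩ => ⟨Set.image2 (· * ·) F F', hF.image2 _ hF',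
    fun x z ⟨y, hxy, hyz⟩ => ⟨_, h x y hxy, _, h' y z hyz, by group⟩⟩

/-- Families indexed by `Fin (n + 1)` that cover `W` and are bounded and disjoint give a
multicover of multiplicity one. -/
theorem hasMulticover_of_families {α : Type*} {E D : α → α → Prop} {n : ℕ} {W : Set α}
    (U : Fin (n + 1) → Set (Set α)) (hD : ∀ i, ∀ V ∈ U i, ∀ x ∈ V, ∀ y ∈ V, D x y)
    (hE : ∀ i, ∀ V ∈ U i, ∀ V' ∈ U i, V ≠ V' → ∀ x ∈ V, ∀ y ∈ V', ¬ E x y)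
    (hW : ∀ x ∈ W, ∃ i, ∃ V ∈ U i, x ∈ V) : HasMulticover W E D (n + 1) 1 := by
  refine ⟨fun i => if hi : i < n + 1 then ⋃₀ U ⟨i, hi⟩ else ∅, fun i hi => ?_, fun x hx => ?_⟩
  · simp only [hi, dif_pos]
    exact hasBoundedComponents_sUnion (hD _) (hE _)
  · obtain ⟨i, V, hV, hxV⟩ := hW x hx
    refine multiplicity_pos_iff.2 ⟨i, i.2, ?_⟩
    simp only [i.2, dif_pos]
    exact ⟨V, hV, hxV⟩

theorem HasAsdimLE.hasUniformMulticovers {X : Type*} [MetricSpace X] {n : ℕ}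
    (h : HasAsdimLE (fun x y : X => dist x y) n) :
    (metricCoarseStructure X).HasUniformMulticovers {Set.univ} (n + 1) 1 := by
  rintro E ⟨r, hr⟩
  obtain ⟨R, U, hb, hd, hc⟩ := h (max r 1) (by positivity)
  refine ⟨fun x y => dist x y ≤ R, ⟨R, fun _ _ h => h⟩, ?_⟩
  rintro _ rfl
  exact hasMulticover_of_families U hb (fun i V hV V' hV' hne x hx y hy hxy =>
    (((hr x y hxy).trans (le_max_left r 1)).trans_lt (hd i V hV V' hV' hne x hx y hy)).false)
    fun x _ => hc x

theorem SubsetHasAsdimLE.mono {Γ : Type*} [Group Γ] {W : Set Γ} {m n : ℕ} (hmn : m ≤ n)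
    (h : SubsetHasAsdimLE W m) : SubsetHasAsdimLE W n := by
  intro L hL
  obtain ⟨B, hB, U, hU, hdisj, hcov⟩ := h L hL
  refine ⟨B, hB, fun i => if hi : i.1 < m + 1 then U ⟨i, hi⟩ else ∅, fun i A hA => ?_,
    fun i A hA A' hA' hne => ?_, fun x hx => ?_⟩
  · by_cases hi : i.1 < m + 1
    · simp only [hi, dif_pos] at hA
      exact hU _ A hA
    · simp [hi] at hA
  · by_cases hi : i.1 < m + 1
    · simp only [hi, dif_pos] at hA hA'
      exact hdisj _ A hA A' hA' hne
    · simp [hi] at hA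
  · obtain ⟨i, A, hA, hxA⟩ := hcov x hx
    refine ⟨⟨i, by omega⟩, A, ?_, hxA⟩
    have hi : i.1 < m + 1 := i.2
    simpa only [hi, dif_pos] using hA

theorem subsetHasAsdimLE_of_subsetAsdim_le {Γ : Type*} [Group Γ] {W : Set Γ} {n : ℕ}
    (h : subsetAsdim W ≤ n) : SubsetHasAsdimLE W n := by
  by_contra hn
  have : ((n + 1 : ℕ) : ℕ∞) ≤ subsetAsdim W := le_iInf₂ fun m hm => by
    by_contra hlt
    exact hn (hm.mono (by exact_mod_cast Order.lt_add_one_iff.1 (by exact_mod_cast not_le.1 hlt)))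
  have := this.trans h
  norm_cast at this
  omega

theorem exists_controlled_orbit {Γ X : Type*} [Group Γ] [MetricSpace X] [MulAction Γ X]
    [IsIsometricSMul Γ X] {x₀ : X} (E : Γ → Γ → Prop) (hE : (groupCoarseStructure Γ).Controlled E) :
    ∃ E', (metricCoarseStructure X).Controlled E' ∧ ∀ g h, E g h → E' (g • x₀) (h • x₀) := by
  obtain ⟨F, hF, hEF⟩ := hE
  obtain ⟨R, hR⟩ := (hF.image fun g => dist x₀ (g • x₀)).bddAbove
  refine ⟨fun x y => dist x y ≤ R, ⟨R, fun _ _ h => h⟩, fun g h hgh => ?_⟩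
  have : dist x₀ ((g⁻¹ * h) • x₀) ≤ R := hR ⟨_, hEF g h hgh, rfl⟩
  rwa [mul_smul, ← dist_smul g, smul_inv_smul] at this

/-- The sets of bounded image under the orbit map have asymptotic dimension at most `n` uniformly:
a nonempty set of this kind is a left translate of a subset of an `R`-stabilizer, and the coarse
structure of the group is left invariant. -/
theorem hasUniformMulticovers_orbit {Γ X : Type*} [Group Γ] [MetricSpace X] [MulAction Γ X]
    [IsIsometricSMul Γ X] {x₀ : X} {n : ℕ}
    (hW : ∀ R : ℝ, 0 < R → SubsetHasAsdimLE (rStabilizer Γ R x₀) n)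
    {T : X → X → Prop} (hT : (metricCoarseStructure X).Controlled T) :
    (groupCoarseStructure Γ).HasUniformMulticovers
      {C | ∀ g ∈ C, ∀ h ∈ C, T (g • x₀) (h • x₀)} (n + 1) 1 := by
  obtain ⟨R, hR⟩ := hT
  rintro E ⟨F, hF, hEF⟩
  obtain ⟨B, hB, U, hU, hdisj, hcov⟩ := hW (max R 1) (by positivity) {p | p.1⁻¹ * p.2 ∈ F}
    (hF.subset (by rintro _ ⟨p, hp, rfl⟩; exact hp))
  refine ⟨fun x y => x⁻¹ * y ∈ (fun p : Γ × Γ => p.1⁻¹ * p.2) '' B, ⟨_, hB, fun _ _ h => h⟩,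
    fun C hC => ?_⟩
  rcases C.eq_empty_or_nonempty with rfl | ⟨g, hg⟩
  · exact ⟨fun _ => ∅, fun _ _ => hasBoundedComponents_empty, fun _ h => h.elim⟩
  · obtain ⟨A, hA, hAcov⟩ := hasMulticover_of_families (W := rStabilizer Γ (max R 1) x₀)
      (E := fun x y => x⁻¹ * y ∈ F)
      (D := fun x y => x⁻¹ * y ∈ (fun p : Γ × Γ => p.1⁻¹ * p.2) '' B) U
      (fun i V hV x hx y hy => ⟨(x, y), (hU i V hV).2 ⟨hx, hy⟩, rfl⟩)
      (fun i V hV V' hV' hne x hx y hy hxy =>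
        Set.disjoint_left.1 (hdisj i V hV V' hV' hne) (Set.mk_mem_prod hx hy) hxy) hcov
    refine ⟨fun i => (g⁻¹ * ·) ⁻¹' A i, fun i hi => ?_, fun h hh => ?_⟩
    · have := (hA i hi).preimage (E' := E) (g⁻¹ * ·) fun x y hxy => by
        have := hEF x y hxy
        simpa [mul_assoc] using this
      refine this.mono le_rfl (fun x y hxy => ?_) subset_rfl
      simpa only [mul_inv_rev, inv_inv, mul_assoc, mul_inv_cancel_left] using hxy
    · refine hAcov (g⁻¹ * h) ?_
      have h1 : dist (h • x₀) (g • x₀) ≤ R := hR _ _ (hC h hh g hg)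
      change dist ((g⁻¹ * h) • x₀) x₀ ≤ max R 1
      rw [mul_smul, ← dist_smul g, smul_inv_smul]
      exact h1.trans (le_max_left _ _)

/-! ### Word metrics -/

section WordMetric

variable {Γ : Type*} [Group Γ]

theorem exists_word_of_mem_closure {S : Set Γ} {g : Γ} (hg : g ∈ Subgroup.closure S) :
    ∃ l : List Γ, l.length = wordLength S g ∧ (∀ s ∈ l, s ∈ S ∨ s⁻¹ ∈ S) ∧ l.prod = g := by
  rw [← Subgroup.mem_toSubmonoid, Subgroup.closure_toSubmonoid] at hg
  obtain ⟨l, hl, hlg⟩ := Submonoid.exists_list_of_mem_closure hg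
  exact Nat.sInf_mem (s := {k | ∃ l : List Γ, l.length = k ∧ (∀ s ∈ l, s ∈ S ∨ s⁻¹ ∈ S) ∧
    l.prod = g}) ⟨_, l, rfl, hl, hlg⟩

theorem finite_setOf_wordLength_le {S : Set Γ} (hS : S.Finite) (N : ℕ) :
    {g | g ∈ Subgroup.closure S ∧ wordLength S g ≤ N}.Finite := by
  have hfin : {l : List Γ | l.length ≤ N ∧ ∀ s ∈ l, s ∈ S ∪ S⁻¹}.Finite := by
    have : Finite (S ∪ S⁻¹ : Set Γ) := (hS.union hS.inv).to_subtype
    refine ((List.finite_length_le (S ∪ S⁻¹ : Set Γ) N).image (List.map Subtype.val)).subset ?_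
    rintro l ⟨hl, hlS⟩
    exact ⟨l.attach.map fun s => ⟨s.1, hlS s.1 s.2⟩, by simpa using hl, by simp⟩
  refine (hfin.image List.prod).subset ?_
  rintro g ⟨hg, hN⟩
  obtain ⟨l, hl, hlS, hlg⟩ := exists_word_of_mem_closure hg
  exact ⟨l, ⟨hl.trans_le hN, hlS⟩, hlg⟩

theorem hasAsdimLE_wordDist {n : ℕ}
    (h : (groupCoarseStructure Γ).HasUniformMulticovers {Set.univ} (n + 1) 1)
    {S : Set Γ} (hS : S.Finite) : HasAsdimLE (wordDist S) n := by
  intro r _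
  obtain ⟨E, hE, hle, -, hsymm⟩ := (groupCoarseStructure Γ).exists_reflexive_symmetric
    (E := fun x y => x⁻¹ * y ∈ {g | g ∈ Subgroup.closure S ∧ wordLength S g ≤ ⌊r⌋₊})
    ⟨_, finite_setOf_wordLength_le hS _, fun _ _ h => h⟩
  obtain ⟨D, ⟨F, hF, hDF⟩, hcov⟩ := h E hE
  obtain ⟨A, hA, hAcov⟩ := hcov _ rfl
  choose U hUD hUE hUA using fun i : Fin (n + 1) => (hA i i.2).exists_family hsymm
  obtain ⟨N, hN⟩ := (hF.image (wordLength S)).bddAbove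
  refine ⟨N, fun i => (Subtype.val ⁻¹' ·) '' U i, fun i => ?_, fun i => ?_, fun x => ?_⟩
  · rintro _ ⟨V, hV, rfl⟩ x hx y hy
    exact Nat.cast_le.2 (hN ⟨_, hDF _ _ (hUD i V hV x hx y hy), rfl⟩)
  · rintro _ ⟨V, hV, rfl⟩ _ ⟨V', hV', rfl⟩ hne x hx y hy
    by_contra hlt
    have hxy : wordLength S ((x : Γ)⁻¹ * y) ≤ ⌊r⌋₊ := Nat.le_floor (not_lt.1 hlt)
    exact hUE i V hV V' hV' (fun h => hne (by rw [h])) x hx y hy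
      (hle _ _ ⟨mul_mem (inv_mem x.2) y.2, hxy⟩)
  · obtain ⟨i, hi, hx⟩ := multiplicity_pos_iff.1 (hAcov (x : Γ) trivial)
    rw [← hUA ⟨i, hi⟩] at hx
    obtain ⟨V, hV, hxV⟩ := hx
    exact ⟨⟨i, hi⟩, _, ⟨V, hV, rfl⟩, hxV⟩

end WordMetric

end AsymptoticDimension

theorem theorem2p2 {Γ X : Type*} [Group Γ] [MetricSpace X] [MulAction Γ X] [IsIsometricSMul Γ X]
    (hX : AsymptoticDimension.IsGeodesicSpace X) (x₀ : X) (n : ℕ)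
    (hW : ∀ R : ℝ, 0 < R →
      AsymptoticDimension.subsetAsdim (AsymptoticDimension.rStabilizer Γ R x₀) ≤ (n : ℕ∞)) :
    AsymptoticDimension.groupAsdim Γ ≤ (n : ℕ∞) + AsymptoticDimension.asdim X := by
  have hW' := fun R hR => AsymptoticDimension.subsetHasAsdimLE_of_subsetAsdim_le (hW R hR)
  unfold AsymptoticDimension.asdim AsymptoticDimension.asdimOf
  simp only [ENat.add_iInf]
  refine iSup_le fun S => le_iInf₂ fun m hm => ?_
  have key := AsymptoticDimension.CoarseStructure.hurewicz (f := fun g : Γ => g • x₀)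
    AsymptoticDimension.exists_controlled_orbit hm.hasUniformMulticovers
    fun T hT => AsymptoticDimension.hasUniformMulticovers_orbit hW' hT
  exact (iInf₂_le _ (AsymptoticDimension.hasAsdimLE_wordDist key S.finite_toSet)).trans
    (by push_cast; rfl)
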